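/- Let $k\ge 1$ be an integer and let $S\in\mathbb{C}[x]$ be a nonzero polynomial with only simple roots whose degree is coprime to $k$. Let $\mathcal{C}=\{(x,y)\in\mathbb{C}^2 : y^k=S(x)\}$ be the associated superelliptic curve. A divisor on $\mathcal{C}$ is a function $D:\mathcal{C}\to\mathbb{Z}$ with finite support; it is called principal if there is a nonzero rational function $f$ on $\mathcal{C}$ such that $D(z)=\operatorname{ord}_z f$ for every $z\in\mathcal{C}$. Then for every divisor $D$ on $\mathcal{C}$ with non-negative values there exists a principal divisor $D'$ on $\mathcal{C}$ such that the support of $D'-D$ contains at most $(k-1)(\deg S-1)/2$ points. -/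

import Mathlib

open Polynomial

noncomputable section

namespace Superelliptic

/-- The (affine) superelliptic curve `y ^ k = S(x)` in `ℂ²`; a point is a pair `(x, y)`. -/
def Curve (k : ℕ) (S : ℂ[X]) : Set (ℂ × ℂ) :=
  {z | z.2 ^ k = S.eval z.1}

/-- A divisor on the curve: a function from its points to `ℤ` with finite support. -/
abbrev Divisor (k : ℕ) (S : ℂ[X]) : Type := Curve k S →₀ ℤ

/-- The coordinate ring `ℂ[x][y] / (y ^ k - S(x))` of the curve. The inner variable is `x`, the
outer variable is `y`. -/
abbrev CoordinateRing (k : ℕ) (S : ℂ[X]) : Type :=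
  AdjoinRoot ((X : ℂ[X][X]) ^ k - C S)

/-- The rational functions on the curve: the fractions of its coordinate ring. -/
abbrev FunctionField (k : ℕ) (S : ℂ[X]) : Type :=
  FractionRing (CoordinateRing k S)

variable {k : ℕ} {S : ℂ[X]}

/-- Evaluation of regular functions at a point of the curve: `x` goes to the first coordinate of
the point and `y` to the second one. -/
def evalAt (z : Curve k S) : CoordinateRing k S →+* ℂ :=
  AdjoinRoot.lift (Polynomial.evalRingHom z.1.1) z.1.2 (by
    have h : z.1.2 ^ k = S.eval z.1.1 := z.2
    simp [h])

/-- The maximal ideal of the regular functions that vanish at a point. -/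
def pointIdeal (z : Curve k S) : Ideal (CoordinateRing k S) :=
  RingHom.ker (evalAt z)

instance pointIdeal_isPrime (z : Curve k S) : (pointIdeal z).IsPrime :=
  RingHom.ker_isPrime (evalAt z)

/-- The local ring of the curve at a point. -/
abbrev LocalRing (z : Curve k S) : Type :=
  Localization.AtPrime (pointIdeal z)

/-- The order of vanishing at the point `z` of a regular function `g`: the length of the
quotient of the local ring at `z` by `g`. -/
def ord (z : Curve k S) (g : CoordinateRing k S) : ℕ∞ :=
  Ring.ord (LocalRing z) (algebraMap (CoordinateRing k S) (LocalRing z) g)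

/-- `HasOrd z f n` says that the rational function `f` has order `n` at the point `z`: writing
`f = g / h` with `g`, `h` regular, the order of `g` at `z` minus the order of `h` at `z` is `n`
(see `HasOrd.unique`: `n` does not depend on how `f` is written as a fraction). -/
def HasOrd (z : Curve k S) (f : FunctionField k S) (n : ℤ) : Prop :=
  ∃ g h : CoordinateRing k S, h ∈ nonZeroDivisors (CoordinateRing k S) ∧
    f * algebraMap (CoordinateRing k S) (FunctionField k S) h =
      algebraMap (CoordinateRing k S) (FunctionField k S) g ∧
    ∃ a b : ℕ, ord z g = a ∧ ord z h = b ∧ n = (a : ℤ) - (b : ℤ)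

theorem ord_mul (z : Curve k S) (g : CoordinateRing k S) {h : CoordinateRing k S}
    (hh : h ∈ nonZeroDivisors (CoordinateRing k S)) : ord z (g * h) = ord z g + ord z h := by
  unfold ord
  rw [map_mul]
  exact Ring.ord_mul _ (IsLocalization.map_nonZeroDivisors_le (pointIdeal z).primeCompl _
    (Submonoid.mem_map_of_mem _ hh))

theorem HasOrd.unique {z : Curve k S} {f : FunctionField k S} {m n : ℤ}
    (hm : HasOrd z f m) (hn : HasOrd z f n) : m = n := by
  obtain ⟨g, h, hh, hf, a, b, ha, hb, rfl⟩ := hm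
  obtain ⟨g', h', hh', hf', a', b', ha', hb', rfl⟩ := hn
  have key : g * h' = g' * h := by
    apply IsFractionRing.injective (CoordinateRing k S) (FunctionField k S)
    rw [map_mul, map_mul, ← hf, ← hf']
    ring
  have := congrArg (ord z) key
  rw [ord_mul z g hh', ord_mul z g' hh, ha, hb, ha', hb'] at this
  have : a + b' = a' + b := by exact_mod_cast this
  omega

/-- A divisor is principal if it is the divisor of a nonzero rational function: its value at each
point of the curve is the order of the function there. -/
def IsPrincipal (D : Divisor k S) : Prop :=
  ∃ f : FunctionField k S, f ≠ 0 ∧ ∀ z : Curve k S, HasOrd z f (D z)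

end Superelliptic

end

noncomputable section

namespace Superelliptic

/-! The curve has a single place at infinity, where `x` has a pole of order `k` and `y` one of order
`d = deg S`. The argument is Riemann's inequality in affine form: the pole order at infinity is
replaced by a filtration of the coordinate ring `A`, and no projective model is needed.

Let `F M` be the span of the monomials `x ^ i * y ^ j` with `k * i + d * j ≤ M`, and let `g = (k -
1) * (d - 1) / 2`. Coprimality makes the weights `d * j`, `j < k`, run through all residues modulo
`k`; hence `dim F M ≥ M + 1 - g`, with equality for large `M` (`le_two_mul_card_weightSet`,
`two_mul_card_weightSet`).

Simple roots make the curve smooth, so `A` is a Dedekind domain, and a product of `n` point ideals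
has codimension `n` (`finrank_quotient_prod`). For an effective divisor `E` of degree `n`, the
inequality `dim F (n + g) > n` yields a nonzero `f ∈ F (n + g)` vanishing on `E`. Conversely, such
an `f` has at most `n + g` zeros with multiplicity: multiplication by `f` maps `F N` into `F (N + n
+ g)`, which bounds the codimension of every ideal containing `f`
(`finrank_quotient_le_of_mem_filtration`). So `div f = E + H` with `H` effective of degree at most
`g`, and `H` has at most `g` points in its support. -/

/-- A quotient that is covered by the images of a monotone family of subspaces of dimension at
most `w` has dimension at most `w`. -/
theorem rank_le_of_iSup_finrank_le {K V : Type*} [Field K] [AddCommGroup V] [Module K V]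
    (G : ℕ → Submodule K V) (hG : Monotone G) (hcov : ∀ v, ∃ M, v ∈ G M)
    (hfin : ∀ M, FiniteDimensional K (G M)) (w M₀ : ℕ)
    (hw : ∀ M, M₀ ≤ M → Module.finrank K (G M) ≤ w) :
    Module.Finite K V ∧ Module.finrank K V ≤ w := by
  have hr : Module.rank K V ≤ w := by
    refine rank_le fun s hs => ?_
    choose μ hμ using hcov
    -- One index large enough that the whole finite independent family lies in a single piece.
    let M := M₀ + s.sup μ
    have hmem : ∀ v : s, (v : V) ∈ G M := fun v =>
      hG ((Finset.le_sup (f := μ) v.2).trans (Nat.le_add_left _ _)) (hμ v)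
    let φ : s → G M := fun v => ⟨v, hmem v⟩
    have hφ : LinearIndependent K φ := by
      refine LinearIndependent.of_comp (G M).subtype ?_
      exact hs
    have := hfin M
    have h := hφ.fintype_card_le_finrank
    simp only [Fintype.card_coe] at h
    exact h.trans (hw M (Nat.le_add_right _ _))
  have hfinite : Module.Finite K V :=
    Module.rank_lt_aleph0_iff.mp (hr.trans_lt (Cardinal.natCast_lt_aleph0))
  refine ⟨hfinite, ?_⟩
  rw [← Module.finrank_eq_rank] at hr
  exact_mod_cast hr

/-! ### Filtered algebras: codimension of ideals -/

section Filtration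

variable {K A : Type*} [Field K] [CommRing A] [Algebra K A] (F : ℕ → Submodule K A)

/-- In a filtered domain whose pieces have dimension `M + 1 - g` for large `M`, an ideal
containing a nonzero element of weight `w` has codimension at most `w`. -/
theorem finrank_quotient_le_of_mem_filtration [IsDomain A] (hmono : Monotone F)
    (hcov : ∀ a, ∃ M, a ∈ F M)
    (hfin : ∀ M, FiniteDimensional K (F M)) (hmul : ∀ m n, ∀ a ∈ F m, ∀ b ∈ F n, a * b ∈ F (m + n))
    (g M₀ : ℕ) (hdim : ∀ M, M₀ ≤ M → Module.finrank K (F M) + g = M + 1)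
    {w : ℕ} {f : A} (hf0 : f ≠ 0) (hf : f ∈ F w) {J : Ideal A} (hJ : f ∈ J) :
    Module.Finite K (A ⧸ J) ∧ Module.finrank K (A ⧸ J) ≤ w := by
  let π : A →ₗ[K] A ⧸ J := (Ideal.Quotient.mkₐ K J).toLinearMap
  refine rank_le_of_iSup_finrank_le (fun M => (F M).map π)
    (fun _ _ h => Submodule.map_mono (hmono h)) ?_ (fun M => inferInstance) w (M₀ + w) ?_
  · intro v
    obtain ⟨a, rfl⟩ := Ideal.Quotient.mk_surjective v
    obtain ⟨M, hM⟩ := hcov a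
    exact ⟨M, a, hM, rfl⟩
  · intro M hM
    obtain ⟨N, rfl⟩ : ∃ N, M = N + w := ⟨M - w, by omega⟩
    have hN : M₀ ≤ N := by omega
    let ψ : F (N + w) →ₗ[K] A ⧸ J := π.domRestrict (F (N + w))
    have hrange : LinearMap.range ψ = (F (N + w)).map π := LinearMap.range_domRestrict _ _
    have hrn := LinearMap.finrank_range_add_finrank_ker ψ
    -- Multiplication by `f` lands in `J`, so the kernel has dimension at least `N + 1 - g`; the
    -- image of `F (N + w)` keeps at most `(N + w + 1 - g) - (N + 1 - g) = w`.
    let μ : F N →ₗ[K] LinearMap.ker ψ :=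
      { toFun := fun a => ⟨⟨a * f, hmul _ _ _ a.2 _ hf⟩, by
          change Ideal.Quotient.mk J (a * f) = 0
          exact Ideal.Quotient.eq_zero_iff_mem.mpr (J.mul_mem_left _ hJ)⟩
        map_add' := fun a b => by ext; simp [add_mul]
        map_smul' := fun c a => by ext; simp }
    have hμ : Function.Injective μ := by
      intro a b hab
      have : (a : A) * f = b * f :=
        congrArg (fun c : LinearMap.ker ψ => ((c : F (N + w)) : A)) hab
      exact Subtype.ext (mul_right_cancel₀ hf0 this)
    have h1 := LinearMap.finrank_le_finrank_of_injective hμ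
    have h2 := hdim N hN
    have h3 := hdim (N + w) (by omega)
    rw [hrange] at hrn
    omega

/-- A filtered piece whose dimension exceeds the codimension of an ideal meets that ideal. -/
theorem exists_ne_zero_mem_filtration {M : ℕ} (J : Ideal A) [Module.Finite K (A ⧸ J)]
    [FiniteDimensional K (F M)]
    (h : Module.finrank K (A ⧸ J) < Module.finrank K (F M)) : ∃ f ∈ J, f ≠ 0 ∧ f ∈ F M := by
  let π : A →ₗ[K] A ⧸ J := (Ideal.Quotient.mkₐ K J).toLinearMap
  let ψ : F M →ₗ[K] A ⧸ J := π.domRestrict (F M)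
  obtain ⟨a, ha, ha0⟩ := Submodule.exists_mem_ne_zero_of_ne_bot
    (LinearMap.ker_ne_bot_of_finrank_lt (f := ψ) h)
  refine ⟨a, ?_, fun h => ha0 (Subtype.ext h), a.2⟩
  exact Ideal.Quotient.eq_zero_iff_mem.mp ha

end Filtration

/-! ### Counting monomials of bounded weight -/

section Count

/-- The exponents `(i, j)` with `j < k` of the monomials of weight at most `M`. -/
def weightSet (k d M : ℕ) : Finset (ℕ × ℕ) :=
  (Finset.range (M + 1) ×ˢ Finset.range k).filter fun p => k * p.1 + d * p.2 ≤ M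

theorem mem_weightSet {k d M : ℕ} (hk : 1 ≤ k) {p : ℕ × ℕ} :
    p ∈ weightSet k d M ↔ p.2 < k ∧ k * p.1 + d * p.2 ≤ M := by
  simp only [weightSet, Finset.mem_filter, Finset.mem_product, Finset.mem_range]
  constructor
  · tauto
  · rintro ⟨h1, h2⟩
    refine ⟨⟨?_, h1⟩, h2⟩
    nlinarith

theorem card_weightSet (k d M : ℕ) :
    (weightSet k d M).card = ∑ j ∈ Finset.range k,
      ((Finset.range (M + 1)).filter fun i => k * i + d * j ≤ M).card := by
  simp only [weightSet, Finset.card_filter, Finset.sum_product_right]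

/-- For `c > M` the row is empty, while the floor is at most `-1`; the maximum with `0` covers this
case. -/
theorem card_row {k : ℕ} (hk : 1 ≤ k) (c M : ℕ) :
    (((Finset.range (M + 1)).filter fun i => k * i + c ≤ M).card : ℤ) =
      max 0 (((M : ℤ) - c) / k + 1) := by
  by_cases hc : c ≤ M
  · obtain ⟨N, rfl⟩ := Nat.exists_eq_add_of_le hc
    have : ((Finset.range (c + N + 1)).filter fun i => k * i + c ≤ c + N) =
        Finset.range (N / k + 1) := by
      ext i
      simp only [Finset.mem_filter, Finset.mem_range, Nat.lt_succ_iff,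
        Nat.le_div_iff_mul_le (by omega : 0 < k)]
      constructor
      · rintro ⟨-, h⟩; linarith
      · intro h
        constructor <;> nlinarith
    rw [this, Finset.card_range]
    have h0 : (0 : ℤ) ≤ (N : ℤ) / k := by positivity
    push_cast
    rw [add_sub_cancel_left, max_eq_right (by omega)]
  · have : ((Finset.range (M + 1)).filter fun i => k * i + c ≤ M) = ∅ := by
      apply Finset.filter_eq_empty_iff.mpr
      intro i _ h
      exact hc (by omega)
    rw [this, max_eq_left]
    · simp
    · have : ((M : ℤ) - c) / k < 0 := Int.ediv_neg_of_neg_of_pos (by omega) (by omega)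
      omega

/-- Since `d` is invertible modulo `k`, the map `j ↦ M - d * j` permutes the residues modulo `k`. -/
theorem sum_emod_of_coprime {k d : ℕ} (hk : 1 ≤ k) (hcop : Nat.Coprime d k) (M : ℤ) :
    ∑ j ∈ Finset.range k, (M - d * j) % k = ∑ j ∈ Finset.range k, (j : ℤ) := by
  have hk0 : (k : ℤ) ≠ 0 := by omega
  have hnn : ∀ j : ℕ, 0 ≤ (M - d * j) % k := fun j => Int.emod_nonneg _ hk0
  have hlt : ∀ j : ℕ, (M - d * j) % k < k := fun j => Int.emod_lt_of_pos _ (by omega)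
  let r : ℕ → ℕ := fun j => ((M - d * j) % k).toNat
  have hinj : Set.InjOn r (Finset.range k : Set ℕ) := by
    intro i hi j hj hij
    simp only [Finset.coe_range, Set.mem_Iio] at hi hj
    have h : (M - d * i) % k = (M - d * j) % k := by
      have := congrArg (Nat.cast : ℕ → ℤ) hij
      simpa only [r, Int.toNat_of_nonneg (hnn _)] using this
    have h1 : (k : ℤ) ∣ d * ((j : ℤ) - i) := by
      have := Int.ModEq.dvd h.symm
      convert! this using 1
      ring
    have h2 : (k : ℤ) ∣ (j : ℤ) - i :=
      IsCoprime.dvd_of_dvd_mul_left (Nat.isCoprime_iff_coprime.mpr hcop.symm) h1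
    have h3 : (j : ℤ) - i = 0 := Int.eq_zero_of_abs_lt_dvd h2 (by rw [abs_lt]; omega)
    omega
  have himg : (Finset.range k).image r = Finset.range k := by
    apply Finset.eq_of_subset_of_card_le
    · intro x hx
      obtain ⟨j, -, rfl⟩ := Finset.mem_image.mp hx
      have := hlt j
      have := hnn j
      simp only [Finset.mem_range, r]
      omega
    · rw [Finset.card_image_of_injOn hinj]
  calc ∑ j ∈ Finset.range k, (M - d * j) % k = ∑ j ∈ Finset.range k, (r j : ℤ) :=
        Finset.sum_congr rfl fun j _ => (Int.toNat_of_nonneg (hnn j)).symm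
    _ = ∑ j ∈ (Finset.range k).image r, (j : ℤ) := (Finset.sum_image hinj).symm
    _ = _ := by rw [himg]

/-- Write `k` times each floor as the dividend minus its residue; by the permutation of residues,
these add up to `k * (k - 1) / 2`. -/
theorem two_mul_sum_ediv {k d : ℕ} (hk : 1 ≤ k) (hcop : Nat.Coprime d k) (M : ℤ) :
    2 * ∑ j ∈ Finset.range k, ((M - d * j) / k + 1) = 2 * (M + 1) - (k - 1) * (d - 1) := by
  have hk0 : (k : ℤ) ≠ 0 := by omega
  have hG : 2 * ∑ j ∈ Finset.range k, (j : ℤ) = k * (k - 1) := by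
    have := Finset.sum_range_id_mul_two k
    have h2 : (((∑ j ∈ Finset.range k, j) * 2 : ℕ) : ℤ) = ((k * (k - 1) : ℕ) : ℤ) := by rw [this]
    push_cast [Nat.cast_sub hk] at h2
    linarith
  have h1 : k * ∑ j ∈ Finset.range k, ((M - d * j) / k + 1) =
      ∑ j ∈ Finset.range k, (M - d * j - (M - d * j) % k + k) := by
    rw [Finset.mul_sum]
    refine Finset.sum_congr rfl fun j _ => ?_
    have := Int.mul_ediv_add_emod (M - d * j) k
    linarith
  rw [Finset.sum_add_distrib (f := fun j : ℕ => M - d * j - (M - d * j) % k),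
    Finset.sum_sub_distrib, sum_emod_of_coprime hk hcop, Finset.sum_sub_distrib,
    ← Finset.mul_sum] at h1
  simp only [Finset.sum_const, Finset.card_range, nsmul_eq_mul] at h1
  apply mul_left_cancel₀ hk0
  linear_combination 2 * h1 - (d + 1) * hG

/-- Dropping the truncation at `0` in each row can only lower the count, so this bound holds for
every `M`. -/
theorem le_two_mul_card_weightSet {k d : ℕ} (hk : 1 ≤ k) (hcop : Nat.Coprime d k) (M : ℕ) :
    2 * ((M : ℤ) + 1) - (k - 1) * (d - 1) ≤ 2 * (weightSet k d M).card := by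
  rw [← two_mul_sum_ediv hk hcop, card_weightSet]
  push_cast
  gcongr with j _
  rw [card_row hk]
  push_cast
  exact le_max_right _ _

/-- Once `d * k ≤ M`, no row is truncated and the count is exact. -/
theorem two_mul_card_weightSet {k d : ℕ} (hk : 1 ≤ k) (hcop : Nat.Coprime d k) {M : ℕ}
    (hM : d * k ≤ M) :
    2 * ((weightSet k d M).card : ℤ) = 2 * ((M : ℤ) + 1) - (k - 1) * (d - 1) := by
  rw [← two_mul_sum_ediv hk hcop, card_weightSet]
  push_cast
  congr 1
  refine Finset.sum_congr rfl fun j hj => ?_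
  rw [card_row hk]
  push_cast
  apply max_eq_right
  have hj' : j ≤ k := (Finset.mem_range.mp hj).le
  have : d * j ≤ M := (Nat.mul_le_mul_left d hj').trans hM
  have h0 : (0 : ℤ) ≤ (M - d * j) / k := by
    have : (d : ℤ) * j ≤ M := by exact_mod_cast this
    exact Int.ediv_nonneg (by omega) (by omega)
  omega

/-- The genus `(k - 1) (d - 1) / 2` is a natural number. -/
theorem exists_genus {k d : ℕ} (hk : 1 ≤ k) (hcop : Nat.Coprime d k) :
    ∃ g : ℕ, 2 * (g : ℤ) = ((k : ℤ) - 1) * (d - 1) := by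
  have h := two_mul_card_weightSet hk hcop le_rfl
  have h0 : (0 : ℤ) ≤ ((k : ℤ) - 1) * (d - 1) := by
    rcases Nat.eq_zero_or_pos d with rfl | hd
    · simp at hcop
      simp [hcop]
    · exact mul_nonneg (by omega) (by omega)
  -- The exact count at `M = d * k` exhibits the half-product as an integer.
  exact ⟨(d * k + 1 - (weightSet k d (d * k)).card), by push_cast at h ⊢; omega⟩

end Count

/-! ### Dedekind domains: local criterion, orders, codimension of products -/

section Dedekind

variable {A : Type*} [CommRing A]

/-- A prime of a Noetherian domain that is locally generated by one nonzero element `t` has a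
discrete valuation ring as its localization. -/
theorem isDiscreteValuationRing_of_locally_principal [IsDomain A] [IsNoetherianRing A] (m : Ideal A)
    [m.IsPrime] {t : A} (ht0 : t ≠ 0) (htm : t ∈ m) (h : ∀ g ∈ m, ∃ s, s ∉ m ∧ t ∣ s * g) :
    IsDiscreteValuationRing (Localization.AtPrime m) := by
  have hle : m.primeCompl ≤ nonZeroDivisors A := m.primeCompl_le_nonZeroDivisors
  have hinj : Function.Injective (algebraMap A (Localization.AtPrime m)) :=
    IsLocalization.injective _ hle
  have : IsDomain (Localization.AtPrime m) := IsLocalization.isDomain_localization hle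
  have : IsNoetherianRing (Localization.AtPrime m) :=
    IsLocalization.isNoetherianRing m.primeCompl _ inferInstance
  have htmem : algebraMap A (Localization.AtPrime m) t ∈
      IsLocalRing.maximalIdeal (Localization.AtPrime m) := by
    rw [← IsLocalization.AtPrime.map_eq_maximalIdeal m]
    exact Ideal.mem_map_of_mem _ htm
  have hfield : ¬ IsField (Localization.AtPrime m) := by
    intro hf
    rw [IsLocalRing.isField_iff_maximalIdeal_eq.mp hf, Ideal.mem_bot] at htmem
    exact ht0 (hinj (htmem.trans (map_zero _).symm))
  suffices hspan : IsLocalRing.maximalIdeal (Localization.AtPrime m) =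
      Ideal.span {algebraMap A (Localization.AtPrime m) t} by
    have hprinc : (IsLocalRing.maximalIdeal (Localization.AtPrime m)).IsPrincipal := ⟨_, hspan⟩
    have hiff : IsDiscreteValuationRing (Localization.AtPrime m) ↔
        (IsLocalRing.maximalIdeal (Localization.AtPrime m)).IsPrincipal :=
      (IsDiscreteValuationRing.TFAE _ hfield).out 0 4
    exact hiff.mpr hprinc
  refine le_antisymm ?_ ?_
  · rw [← IsLocalization.AtPrime.map_eq_maximalIdeal m, Ideal.map_le_iff_le_comap]
    intro g hg
    obtain ⟨s, hs, hd⟩ := h g hg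
    rw [Ideal.mem_comap]
    refine Ideal.mem_span_singleton.mpr ?_
    have hu : IsUnit (algebraMap A (Localization.AtPrime m) s) :=
      IsLocalization.map_units _ (⟨s, hs⟩ : m.primeCompl)
    have := map_dvd (algebraMap A (Localization.AtPrime m)) hd
    rwa [map_mul, hu.dvd_mul_left] at this
  · exact (Ideal.span_singleton_le_iff_mem _).mpr htmem

/-- A Noetherian domain whose localizations at the maximal ideals are discrete valuation rings is
a Dedekind domain. -/
theorem isDedekindDomain_of_isMaximal_dvr [IsDomain A] [IsNoetherianRing A]
    (h : ∀ (m : Ideal A) [m.IsMaximal], IsDiscreteValuationRing (Localization.AtPrime m)) :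
    IsDedekindDomain A := by
  have : IsDedekindDomainDvr A := by
    refine { is_dvr_at_nonzero_prime := fun P hP hprime => ?_ }
    obtain ⟨m, hm, hPm⟩ := Ideal.exists_le_maximal P hprime.ne_top
    have hdvr := h m
    have hdisj : Disjoint (m.primeCompl : Set A) P :=
      Set.disjoint_left.mpr fun x hx hxP => hx (hPm hxP)
    have hinj : Function.Injective (algebraMap A (Localization.AtPrime m)) :=
      IsLocalization.injective _ m.primeCompl_le_nonZeroDivisors
    have hQ : (P.map (algebraMap A (Localization.AtPrime m))).IsPrime :=
      IsLocalization.isPrime_of_isPrime_disjoint m.primeCompl _ P hprime hdisj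
    have hQ0 : P.map (algebraMap A (Localization.AtPrime m)) ≠ ⊥ :=
      (Ideal.map_eq_bot_iff_of_injective hinj).not.mpr hP
    have hmax : P.map (algebraMap A (Localization.AtPrime m)) =
        IsLocalRing.maximalIdeal (Localization.AtPrime m) :=
      IsLocalRing.eq_maximalIdeal (hQ.isMaximal hQ0)
    have hPeq : P = m := by
      rw [← IsLocalization.under_map_of_isPrime_disjoint m.primeCompl (Localization.AtPrime m)
        hprime hdisj, hmax, IsLocalization.AtPrime.under_maximalIdeal _ m]
    subst hPeq
    exact hdvr
  infer_instance

/-- In a Dedekind domain the length of the local ring at a prime modulo `f` is the exponent of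
this prime in `f`. -/
theorem exists_ord_eq [IsDedekindDomain A] (m : Ideal A) [m.IsMaximal] (hm : m ≠ ⊥)
    {f : A} (hf : f ≠ 0) :
    ∃ e : ℕ, Ring.ord (Localization.AtPrime m) (algebraMap A _ f) = e ∧
      ∀ n, f ∈ m ^ n ↔ n ≤ e := by
  have : IsDiscreteValuationRing (Localization.AtPrime m) :=
    IsLocalization.AtPrime.isDiscreteValuationRing_of_dedekind_domain A hm _
  have hinj : Function.Injective (algebraMap A (Localization.AtPrime m)) :=
    IsLocalization.injective _ m.primeCompl_le_nonZeroDivisors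
  obtain ⟨ϖ, hϖ⟩ := IsDiscreteValuationRing.exists_irreducible (Localization.AtPrime m)
  have hf' : algebraMap A (Localization.AtPrime m) f ≠ 0 := by
    rwa [Ne, map_eq_zero_iff _ hinj]
  obtain ⟨e, he⟩ := IsDiscreteValuationRing.associated_pow_irreducible hf' hϖ
  refine ⟨e, ?_, fun n => ?_⟩
  · rw [Ring.ord_eq_of_associated he, Ring.ord_pow (mem_nonZeroDivisors_of_ne_zero hϖ.ne_zero),
      Ring.ord_of_irreducible hϖ]
    simp
  · rw [← IsLocalization.AtPrime.under_maximalIdeal_pow m (Localization.AtPrime m) n,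
      Ideal.mem_comap, hϖ.maximalIdeal_eq, Ideal.span_singleton_pow, Ideal.mem_span_singleton,
      he.dvd_iff_dvd_right, pow_dvd_pow_iff hϖ.ne_zero hϖ.not_isUnit]

/-- Multiplying a nonzero ideal by a rational maximal ideal raises the codimension by one. -/
theorem finrank_quotient_mul {K : Type*} [Field K] [Algebra K A] [IsDedekindDomain A]
    (m J : Ideal A) [m.IsMaximal] (hm : m ≠ ⊥)
    (hres : ∀ a : A, ∃ c : K, a - algebraMap K A c ∈ m) (hJ : J ≠ ⊥)
    [Module.Finite K (A ⧸ J)] :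
    Module.Finite K (A ⧸ (m * J)) ∧
      Module.finrank K (A ⧸ (m * J)) = Module.finrank K (A ⧸ J) + 1 := by
  have hle : m * J ≤ J := Ideal.mul_le_right
  have hne : m * J ≠ ⊥ := mul_ne_zero hm hJ
  -- `J = m * J + (a)`, so `J / (m * J)`, the kernel of `A / (m * J) → A / J`, is generated by the
  -- class of `a`.
  obtain ⟨a, ha⟩ := IsDedekindDomain.exists_sup_span_eq hle hne
  have haJ : a ∈ J := by
    rw [← ha]
    exact Ideal.mem_sup_right (Ideal.mem_span_singleton_self a)
  have ham : a ∉ m * J := by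
    intro h
    rw [sup_eq_left.mpr ((Ideal.span_singleton_le_iff_mem _).mpr h)] at ha
    have : m * J = 1 * J := by rw [one_mul, ha]
    have h1 : m = 1 := mul_right_cancel₀ (show J ≠ 0 from hJ) this
    exact Ideal.IsMaximal.ne_top ‹_› (h1.trans Ideal.one_eq_top)
  let φ : A ⧸ (m * J) →ₗ[K] A ⧸ J := (Ideal.Quotient.factorₐ K hle).toLinearMap
  have hφ : Function.Surjective φ := Ideal.Quotient.factor_surjective hle
  have hv : (Ideal.Quotient.mk (m * J) a) ∈ LinearMap.ker φ := by
    change Ideal.Quotient.mk J a = 0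
    exact Ideal.Quotient.eq_zero_iff_mem.mpr haJ
  have hv0 : (⟨_, hv⟩ : LinearMap.ker φ) ≠ 0 := by
    intro h
    exact ham (Ideal.Quotient.eq_zero_iff_mem.mp (congrArg Subtype.val h))
  have hgen : ∀ w : LinearMap.ker φ, ∃ c : K, c • (⟨_, hv⟩ : LinearMap.ker φ) = w := by
    rintro ⟨w, hw⟩
    obtain ⟨b, rfl⟩ := Ideal.Quotient.mk_surjective w
    have hb : b ∈ J := Ideal.Quotient.eq_zero_iff_mem.mp hw
    rw [← ha] at hb
    obtain ⟨u, hu, v, hv', rfl⟩ := Submodule.mem_sup.mp hb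
    obtain ⟨r, rfl⟩ := Ideal.mem_span_singleton'.mp hv'
    -- Modulo `m * J` the coefficient of `a` matters only modulo `m`, hence may be taken to be a
    -- scalar.
    obtain ⟨c, hc⟩ := hres r
    refine ⟨c, Subtype.ext ?_⟩
    change c • Ideal.Quotient.mk (m * J) a = _
    rw [Algebra.smul_def, IsScalarTower.algebraMap_apply K A, Ideal.Quotient.algebraMap_eq,
      ← map_mul, Ideal.Quotient.mk_eq_mk_iff_sub_mem]
    have h1 : (r - algebraMap K A c) * a ∈ m * J := Ideal.mul_mem_mul hc haJ
    have h2 := (m * J).neg_mem ((m * J).add_mem hu h1)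
    convert! h2 using 1
    ring
  have hker1 : Module.finrank K (LinearMap.ker φ) = 1 := finrank_eq_one _ hv0 hgen
  have : Module.Finite K (LinearMap.ker φ) := Module.finite_of_finrank_eq_succ hker1
  have : Module.Finite K ((A ⧸ (m * J)) ⧸ LinearMap.ker φ) :=
    Module.Finite.equiv (φ.quotKerEquivOfSurjective hφ).symm
  have hfin : Module.Finite K (A ⧸ (m * J)) := Module.Finite.of_submodule_quotient (LinearMap.ker φ)
  refine ⟨hfin, ?_⟩
  have := LinearMap.finrank_range_add_finrank_ker φ
  rw [LinearMap.range_eq_top.mpr hφ, finrank_top, hker1] at this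
  exact this.symm

/-- The codimension of a product of `n` rational maximal ideals is `n`. -/
theorem finrank_quotient_prod {K : Type*} [Field K] [Algebra K A] [IsDedekindDomain A]
    {ι : Type*} (m : ι → Ideal A) (hmax : ∀ i, (m i).IsMaximal)
    (hm : ∀ i, m i ≠ ⊥) (hres : ∀ i, ∀ a : A, ∃ c : K, a - algebraMap K A c ∈ m i)
    (s : Multiset ι) :
    (s.map m).prod ≠ ⊥ ∧ Module.Finite K (A ⧸ (s.map m).prod) ∧
      Module.finrank K (A ⧸ (s.map m).prod) = s.card := by
  induction s using Multiset.induction_on with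
  | empty =>
    have : Subsingleton (A ⧸ ((0 : Multiset ι).map m).prod) := by
      rw [Ideal.Quotient.subsingleton_iff, Multiset.map_zero, Multiset.prod_zero, Ideal.one_eq_top]
    refine ⟨?_, inferInstance, ?_⟩
    · simp [Ideal.one_eq_top]
    · rw [Multiset.card_zero]
      exact Module.finrank_zero_of_subsingleton
  | cons i s ih =>
    obtain ⟨h1, h2, h3⟩ := ih
    have := hmax i
    have h := finrank_quotient_mul (K := K) (m i) (s.map m).prod (hm i) (hres i) h1
    rw [Multiset.map_cons, Multiset.prod_cons, Multiset.card_cons]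
    exact ⟨mul_ne_zero (hm i) h1, h.1, by rw [h.2, h3]⟩

/-- Powers of distinct maximal ideals are coprime, so their product is their intersection. -/
theorem mem_prod_of_forall_mem_pow_count {ι : Type*} [DecidableEq ι] (m : ι → Ideal A)
    (hmax : ∀ i, (m i).IsMaximal) (hinj : Function.Injective m) (s : Multiset ι) {f : A}
    (h : ∀ i ∈ s, f ∈ m i ^ s.count i) : f ∈ (s.map m).prod := by
  rw [Finset.prod_multiset_map_count, Ideal.prod_eq_iInf_of_pairwise_isCoprime]
  · simpa using h
  · intro i _ j _ hij
    have h : IsCoprime (m i) (m j) :=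
      Ideal.isCoprime_iff_sup_eq.mpr ((hmax i).coprime_of_ne (hmax j) (hinj.ne hij))
    exact h.pow

theorem mem_pow_count_of_mem_prod {ι : Type*} [DecidableEq ι] (m : ι → Ideal A)
    (s : Multiset ι) {f : A} (h : f ∈ (s.map m).prod) (i : ι) : f ∈ m i ^ s.count i := by
  refine Ideal.le_of_dvd ?_ h
  rw [← Multiset.prod_replicate, ← Multiset.map_replicate]
  exact Multiset.prod_dvd_prod_of_le
    (Multiset.map_le_map (Multiset.le_count_iff_replicate_le.mp le_rfl))

end Dedekind

/-! ### The coordinate ring: integrality, points, smoothness -/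

variable {k : ℕ} {S : ℂ[X]}

/-- Eisenstein's criterion at `x - a` for a root `a` of `S`, which is simple. If `S` is constant,
coprimality forces `k = 1` and the polynomial is linear in `y`. -/
theorem irreducible_curvePolynomial (hk : 1 ≤ k) (hS : Squarefree S)
    (hcop : Nat.Coprime S.natDegree k) : Irreducible ((X : ℂ[X][X]) ^ k - C S) := by
  by_cases hd : S.natDegree = 0
  · have hk1 : k = 1 := by simpa [hd] using hcop
    rw [hk1, pow_one]
    exact (prime_X_sub_C S).irreducible
  · obtain ⟨a, ha⟩ := IsAlgClosed.exists_root S fun h => hd (natDegree_eq_of_degree_eq_some h)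
    have hdvd : X - C a ∣ S := dvd_iff_isRoot.mpr ha
    have hmonic : ((X : ℂ[X][X]) ^ k - C S).Monic := monic_X_pow_sub_C S (by omega)
    have hprime : (Ideal.span {X - C a} : Ideal ℂ[X]).IsPrime :=
      (Ideal.span_singleton_prime (X_sub_C_ne_zero a)).mpr (prime_X_sub_C a)
    refine IsEisensteinAt.irreducible (𝓟 := Ideal.span {X - C a}) ⟨?_, ?_, ?_⟩ hprime
      hmonic.isPrimitive (by rw [natDegree_X_pow_sub_C]; omega)
    · rw [hmonic.leadingCoeff]
      exact fun h => hprime.ne_top ((Ideal.eq_top_iff_one _).mpr h)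
    · intro n hn
      rw [natDegree_X_pow_sub_C] at hn
      rw [coeff_sub, coeff_X_pow, if_neg hn.ne, zero_sub, Ideal.neg_mem_iff, coeff_C]
      split_ifs
      · exact Ideal.mem_span_singleton.mpr hdvd
      · exact Ideal.zero_mem _
    · rw [coeff_sub, coeff_X_pow, if_neg (by omega), zero_sub, Ideal.neg_mem_iff, coeff_C_zero,
        Ideal.span_singleton_pow, Ideal.mem_span_singleton, pow_two]
      exact fun h => (prime_X_sub_C a).not_isUnit (hS _ h)

theorem isDomain_coordinateRing (hk : 1 ≤ k) (hS : Squarefree S)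
    (hcop : Nat.Coprime S.natDegree k) : IsDomain (CoordinateRing k S) :=
  AdjoinRoot.isDomain_of_prime (irreducible_curvePolynomial hk hS hcop).prime

/-- A polynomial in `x` as a regular function. -/
abbrev ofX : ℂ[X] →+* CoordinateRing k S := AdjoinRoot.of _

/-- The coordinate function `y`. -/
abbrev coordY : CoordinateRing k S := AdjoinRoot.root _

theorem coordY_pow : (coordY : CoordinateRing k S) ^ k = ofX S := by
  have := AdjoinRoot.eval₂_root ((X : ℂ[X][X]) ^ k - C S)
  simpa [sub_eq_zero] using this

@[simp]
theorem evalAt_ofX (z : Curve k S) (p : ℂ[X]) : evalAt z (ofX p) = p.eval z.1.1 := by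
  simp [evalAt, ofX]

@[simp]
theorem evalAt_coordY (z : Curve k S) : evalAt z coordY = z.1.2 := by
  simp [evalAt, coordY]

theorem algebraMap_eq_ofX (c : ℂ) : algebraMap ℂ (CoordinateRing k S) c = ofX (C c) := rfl

theorem evalAt_algebraMap (z : Curve k S) (c : ℂ) :
    evalAt z (algebraMap ℂ (CoordinateRing k S) c) = c := by
  rw [algebraMap_eq_ofX, evalAt_ofX, eval_C]

theorem sub_evalAt_mem (z : Curve k S) (g : CoordinateRing k S) :
    g - algebraMap ℂ _ (evalAt z g) ∈ pointIdeal z := by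
  rw [pointIdeal, RingHom.mem_ker, map_sub, evalAt_algebraMap, sub_self]

instance pointIdeal_isMaximal (z : Curve k S) : (pointIdeal z).IsMaximal :=
  RingHom.ker_isMaximal_of_surjective _ fun c => ⟨_, evalAt_algebraMap z c⟩

theorem exists_eq_of_mem_pointIdeal (z : Curve k S) {g : CoordinateRing k S}
    (hg : g ∈ pointIdeal z) :
    ∃ α β, g = α * ofX (X - C z.1.1) + β * (coordY - ofX (C z.1.2)) := by
  let I : Ideal (CoordinateRing k S) := Ideal.span {ofX (X - C z.1.1), coordY - ofX (C z.1.2)}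
  -- Modulo `x - a` and `y - b` every function equals its value at `(a, b)`: it suffices to compare
  -- the two ring homomorphisms on constants, `x` and `y`.
  have key : Ideal.Quotient.mk I =
      ((Ideal.Quotient.mk I).comp (algebraMap ℂ (CoordinateRing k S))).comp (evalAt z) := by
    apply AdjoinRoot.ringHom_ext
    · apply Polynomial.ringHom_ext
      · intro c
        change _ = Ideal.Quotient.mk I (algebraMap ℂ _ (evalAt z (ofX (C c))))
        rw [evalAt_ofX, eval_C]
        rfl
      · change Ideal.Quotient.mk I (ofX X) =
          Ideal.Quotient.mk I (algebraMap ℂ _ (evalAt z (ofX X)))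
        rw [evalAt_ofX, eval_X, Ideal.Quotient.mk_eq_mk_iff_sub_mem, algebraMap_eq_ofX, ← map_sub]
        exact Ideal.subset_span (by simp)
    · change Ideal.Quotient.mk I coordY =
        Ideal.Quotient.mk I (algebraMap ℂ _ (evalAt z coordY))
      rw [evalAt_coordY, Ideal.Quotient.mk_eq_mk_iff_sub_mem, algebraMap_eq_ofX]
      exact Ideal.subset_span (by simp)
  have h := RingHom.congr_fun key g
  rw [RingHom.comp_apply, RingHom.mem_ker.mp hg, map_zero, Ideal.Quotient.eq_zero_iff_mem] at h
  obtain ⟨α, β, h⟩ := Ideal.mem_span_pair.mp h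
  exact ⟨α, β, h.symm⟩

/-- The curve is smooth: the ideal of a point is locally generated by one regular function. -/
theorem exists_local_parameter (hk : 1 ≤ k) (hS : Squarefree S) (z : Curve k S) :
    ∃ t ∈ pointIdeal z, ∀ g ∈ pointIdeal z, ∃ s, s ∉ pointIdeal z ∧ t ∣ s * g := by
  have hz : z.1.2 ^ k = S.eval z.1.1 := z.2
  by_cases hb : z.1.2 = 0
  -- At a branch point `y` is the parameter: `S = (x - a) * T` with `T(a) ≠ 0` because the root is
  -- simple, and `(x - a) * T = y ^ k`.
  · have h0 : IsRoot S z.1.1 := by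
      rw [IsRoot.def, ← hz, hb, zero_pow (by omega)]
    obtain ⟨T, hT⟩ := dvd_iff_isRoot.mpr h0
    refine ⟨coordY, by simp [pointIdeal, RingHom.mem_ker, hb], fun g hg => ?_⟩
    obtain ⟨α, β, rfl⟩ := exists_eq_of_mem_pointIdeal z hg
    refine ⟨ofX T, ?_, ?_⟩
    · rw [pointIdeal, RingHom.mem_ker, evalAt_ofX]
      intro h
      obtain ⟨U, rfl⟩ := dvd_iff_isRoot.mpr (show IsRoot T z.1.1 from h)
      exact (prime_X_sub_C z.1.1).not_isUnit (hS _ ⟨U, hT.trans (mul_assoc _ _ _).symm⟩)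
    · have h1 : (ofX (X - C z.1.1) : CoordinateRing k S) * ofX T = coordY ^ k := by
        rw [coordY_pow, ← map_mul, ← hT]
      refine ⟨α * coordY ^ (k - 1) + ofX T * β, ?_⟩
      rw [hb, map_zero, map_zero, sub_zero]
      have h2 : (coordY : CoordinateRing k S) * coordY ^ (k - 1) = coordY ^ k :=
        mul_pow_sub_one (by omega) _
      linear_combination α * h1 - α * h2
  -- Elsewhere `x - a` is the parameter: `y ^ k - b ^ k = S(x) - S(a)` is divisible by `x - a`, and
  -- the cofactor `U` of `y - b` takes the value `k * b ^ (k - 1) ≠ 0`.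
  · obtain ⟨V, hV⟩ := X_sub_C_dvd_sub_C_eval (p := S) (a := z.1.1)
    refine ⟨ofX (X - C z.1.1), by simp [pointIdeal, RingHom.mem_ker], fun g hg => ?_⟩
    obtain ⟨α, β, rfl⟩ := exists_eq_of_mem_pointIdeal z hg
    let U : CoordinateRing k S :=
      ∑ i ∈ Finset.range k, coordY ^ i * ofX (C z.1.2) ^ (k - 1 - i)
    have hU : U * (coordY - ofX (C z.1.2)) = ofX (X - C z.1.1) * ofX V := by
      rw [geom_sum₂_mul, coordY_pow, ← map_mul, ← hV, map_sub, ← map_pow, ← map_pow, hz]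
    refine ⟨U, ?_, ?_⟩
    · rw [pointIdeal, RingHom.mem_ker]
      simp only [U, map_sum, map_mul, map_pow, evalAt_coordY, evalAt_ofX, eval_C, geom_sum₂_self]
      exact mul_ne_zero (Nat.cast_ne_zero.mpr (by omega)) (pow_ne_zero _ hb)
    · refine ⟨U * α + β * ofX V, ?_⟩
      linear_combination β * hU

theorem pointIdeal_ne_bot (hk : 1 ≤ k) (z : Curve k S) : pointIdeal z ≠ ⊥ := by
  intro h
  -- A point with another abscissa, at which `x - a` does not vanish.
  obtain ⟨b, hb⟩ := IsAlgClosed.exists_pow_nat_eq (S.eval (z.1.1 + 1)) (show 0 < k by omega)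
  let w : Curve k S := ⟨(z.1.1 + 1, b), hb⟩
  have hmem : (ofX (X - C z.1.1) : CoordinateRing k S) ∈ pointIdeal z := by
    simp [pointIdeal, RingHom.mem_ker]
  rw [h, Ideal.mem_bot] at hmem
  have := congrArg (evalAt w) hmem
  rw [evalAt_ofX, map_zero] at this
  simp [w] at this

theorem pointIdeal_injective : Function.Injective (pointIdeal : Curve k S → _) := by
  intro z w h
  have h1 : (ofX (X - C z.1.1) : CoordinateRing k S) ∈ pointIdeal z := by
    simp [pointIdeal, RingHom.mem_ker]
  have h2 : (coordY - ofX (C z.1.2) : CoordinateRing k S) ∈ pointIdeal z := by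
    simp [pointIdeal, RingHom.mem_ker]
  rw [h, pointIdeal, RingHom.mem_ker] at h1 h2
  simp [sub_eq_zero] at h1 h2
  exact Subtype.ext (Prod.ext h1.symm h2.symm)

/-- Every maximal ideal of the coordinate ring is the ideal of a point. -/
theorem exists_eq_pointIdeal (m : Ideal (CoordinateRing k S)) [hm : m.IsMaximal] :
    ∃ z : Curve k S, m = pointIdeal z := by
  let := Ideal.Quotient.field m
  -- Nullstellensatz: the residue field is `ℂ`, and the images of `x` and `y` in it are the
  -- coordinates of the point.
  have hfin : Module.Finite ℂ (CoordinateRing k S ⧸ m) :=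
    finite_of_finite_type_of_isJacobsonRing _ _
  have hbij := IsAlgClosed.algebraMap_bijective_of_isIntegral (k := ℂ)
    (K := CoordinateRing k S ⧸ m)
  obtain ⟨a, ha⟩ := hbij.2 (Ideal.Quotient.mk m (ofX X))
  obtain ⟨b, hb⟩ := hbij.2 (Ideal.Quotient.mk m coordY)
  have hcomp : ∀ p : ℂ[X], Ideal.Quotient.mk m (ofX p) =
      algebraMap ℂ (CoordinateRing k S ⧸ m) (p.eval a) := by
    intro p
    have : (Ideal.Quotient.mk m).comp ofX =
        (algebraMap ℂ (CoordinateRing k S ⧸ m)).comp (evalRingHom a) := by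
      apply Polynomial.ringHom_ext
      · intro c
        rw [RingHom.comp_apply, RingHom.comp_apply, coe_evalRingHom, eval_C]
        rfl
      · rw [RingHom.comp_apply, RingHom.comp_apply, coe_evalRingHom, eval_X, ha]
    exact RingHom.congr_fun this p
  have hz : b ^ k = S.eval a := by
    apply hbij.1
    rw [map_pow, hb, ← map_pow, coordY_pow, hcomp]
  let z : Curve k S := ⟨(a, b), hz⟩
  refine ⟨z, ((pointIdeal_isMaximal z).eq_of_le hm.ne_top fun g hg => ?_).symm⟩
  obtain ⟨α, β, rfl⟩ := exists_eq_of_mem_pointIdeal z hg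
  refine m.add_mem (m.mul_mem_left _ ?_) (m.mul_mem_left _ ?_)
  · rw [← Ideal.Quotient.eq_zero_iff_mem, hcomp]
    simp [z]
  · rw [← Ideal.Quotient.eq_zero_iff_mem, map_sub, hcomp, ← hb]
    simp [z]

theorem isDedekindDomain_coordinateRing (hk : 1 ≤ k) (hS : Squarefree S)
    (hcop : Nat.Coprime S.natDegree k) : IsDedekindDomain (CoordinateRing k S) := by
  have := isDomain_coordinateRing hk hS hcop
  refine isDedekindDomain_of_isMaximal_dvr fun m hm => ?_
  obtain ⟨z, rfl⟩ := exists_eq_pointIdeal m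
  obtain ⟨t, htm, ht⟩ := exists_local_parameter hk hS z
  refine isDiscreteValuationRing_of_locally_principal _ ?_ htm ht
  -- A zero parameter would make the point ideal zero.
  rintro rfl
  refine pointIdeal_ne_bot hk z ((Submodule.eq_bot_iff _).mpr fun g hg => ?_)
  obtain ⟨s, hs, hd⟩ := ht g hg
  refine (mul_eq_zero.mp (zero_dvd_iff.mp hd)).resolve_left ?_
  rintro rfl
  exact hs (Ideal.zero_mem _)

/-! ### The weight filtration and its dimension -/

variable (k S) in
/-- The regular function `x ^ i * y ^ j`. -/
def monomialXY (p : ℕ × ℕ) : CoordinateRing k S := ofX X ^ p.1 * coordY ^ p.2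

theorem monomialXY_mul (p q : ℕ × ℕ) :
    monomialXY k S p * monomialXY k S q = monomialXY k S (p + q) := by
  simp only [monomialXY, Prod.fst_add, Prod.snd_add, pow_add]
  ring

variable (k S) in
/-- The regular functions whose pole at infinity has order at most `M`: the span of the monomials
`x ^ i * y ^ j` with `k * i + deg S * j ≤ M`. -/
def filtration (M : ℕ) : Submodule ℂ (CoordinateRing k S) :=
  Submodule.span ℂ (monomialXY k S '' {p | k * p.1 + S.natDegree * p.2 ≤ M})

theorem filtration_mono : Monotone (filtration k S) := fun _ _ h =>
  Submodule.span_mono (Set.image_mono fun _ hp => le_trans hp h)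

theorem mul_mem_filtration {m n : ℕ} {a b : CoordinateRing k S} (ha : a ∈ filtration k S m)
    (hb : b ∈ filtration k S n) : a * b ∈ filtration k S (m + n) := by
  have h := Submodule.mul_mem_mul ha hb
  rw [filtration, filtration, Submodule.span_mul_span] at h
  refine Submodule.span_mono ?_ h
  rintro _ ⟨_, ⟨p, hp, rfl⟩, _, ⟨q, hq, rfl⟩, rfl⟩
  refine ⟨p + q, ?_, (monomialXY_mul p q).symm⟩
  simp only [Set.mem_ofPred_eq, Prod.fst_add, Prod.snd_add, mul_add] at hp hq ⊢
  omega

/-- Replacing `y ^ k` by `S(x)` does not raise the weight: `y ^ k` weighs `d * k` and each `x ^ n`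
with `n ≤ d` weighs at most that. -/
theorem monomialXY_mem_span (hk : 1 ≤ k) (M : ℕ) (j : ℕ) :
    ∀ i, k * i + S.natDegree * j ≤ M → monomialXY k S (i, j) ∈
      Submodule.span ℂ (monomialXY k S '' (weightSet k S.natDegree M : Set (ℕ × ℕ))) := by
  induction j using Nat.strong_induction_on with
  | _ j ih =>
    intro i hij
    by_cases hj : j < k
    · exact Submodule.subset_span ⟨(i, j), (mem_weightSet hk).mpr ⟨hj, hij⟩, rfl⟩
    · obtain ⟨l, rfl⟩ := Nat.exists_eq_add_of_le (not_lt.mp hj)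
      have hexp : monomialXY k S (i, k + l) =
          ∑ n ∈ Finset.range (S.natDegree + 1), S.coeff n • monomialXY k S (i + n, l) := by
        have hS : (ofX S : CoordinateRing k S) =
            ∑ n ∈ Finset.range (S.natDegree + 1), S.coeff n • (ofX X : CoordinateRing k S) ^ n := by
          refine (congrArg ofX S.as_sum_range_C_mul_X_pow).trans ?_
          rw [map_sum]
          refine Finset.sum_congr rfl fun n _ => ?_
          rw [map_mul, map_pow, Algebra.smul_def, algebraMap_eq_ofX]
        simp only [monomialXY]
        rw [pow_add coordY k l, coordY_pow, hS, Finset.sum_mul, Finset.mul_sum]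
        refine Finset.sum_congr rfl fun n _ => ?_
        rw [pow_add, smul_mul_assoc, mul_smul_comm]
        ring_nf
      rw [hexp]
      refine Submodule.sum_mem _ fun n hn => Submodule.smul_mem _ _ (ih l (by omega) _ ?_)
      have hn' : n ≤ S.natDegree := by simpa [Nat.lt_succ_iff] using hn
      have : k * n ≤ S.natDegree * k := by rw [mul_comm]; exact Nat.mul_le_mul_right k hn'
      rw [mul_add] at hij ⊢
      omega

theorem filtration_eq_span (hk : 1 ≤ k) (M : ℕ) : filtration k S M =
    Submodule.span ℂ (Set.range fun p : weightSet k S.natDegree M => monomialXY k S p) := by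
  have hrange : (Set.range fun p : weightSet k S.natDegree M => monomialXY k S p) =
      monomialXY k S '' (weightSet k S.natDegree M : Set (ℕ × ℕ)) := by
    ext; simp
  rw [hrange]
  apply le_antisymm
  · rw [filtration, Submodule.span_le]
    rintro _ ⟨p, hp, rfl⟩
    exact monomialXY_mem_span hk M p.2 p.1 hp
  · exact Submodule.span_mono (Set.image_mono fun p hp => ((mem_weightSet hk).mp hp).2)

/-- The monomials `x ^ i * y ^ j` with `j < k` form a basis of the coordinate ring. -/
theorem exists_basis_monomialXY (hk : 1 ≤ k) :
    ∃ b : Module.Basis (ℕ × Fin k) ℂ (CoordinateRing k S),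
      ∀ p, b p = monomialXY k S (p.1, p.2) := by
  have hmonic : ((X : ℂ[X][X]) ^ k - C S).Monic := monic_X_pow_sub_C S (by omega)
  have hdim : (AdjoinRoot.powerBasis' hmonic).dim = k := by
    rw [AdjoinRoot.powerBasis'_dim, natDegree_X_pow_sub_C]
  refine ⟨(Polynomial.basisMonomials ℂ).smulTower
    ((AdjoinRoot.powerBasis' hmonic).basis.reindex (finCongr hdim)), fun p => ?_⟩
  rw [Module.Basis.smulTower_apply, Module.Basis.reindex_apply, PowerBasis.coe_basis,
    AdjoinRoot.powerBasis'_gen, coe_basisMonomials, Algebra.smul_def]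
  simp [monomialXY, monomial_one_right_eq_X_pow]

theorem exists_mem_filtration (hk : 1 ≤ k) (a : CoordinateRing k S) :
    ∃ M, a ∈ filtration k S M := by
  obtain ⟨b, hb⟩ := exists_basis_monomialXY (S := S) hk
  induction b.mem_span a using Submodule.span_induction with
  | mem x hx =>
    obtain ⟨p, rfl⟩ := hx
    rw [hb]
    exact ⟨k * p.1 + S.natDegree * p.2,
      Submodule.subset_span ⟨_, le_refl (k * p.1 + S.natDegree * (p.2 : ℕ)), rfl⟩⟩
  | zero => exact ⟨0, Submodule.zero_mem _⟩
  | add x y _ _ hx hy =>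
    obtain ⟨m, hm⟩ := hx
    obtain ⟨n, hn⟩ := hy
    exact ⟨max m n, Submodule.add_mem _ (filtration_mono (le_max_left _ _) hm)
      (filtration_mono (le_max_right _ _) hn)⟩
  | smul c x _ hx =>
    obtain ⟨m, hm⟩ := hx
    exact ⟨m, Submodule.smul_mem _ _ hm⟩

theorem finiteDimensional_filtration (hk : 1 ≤ k) (M : ℕ) :
    FiniteDimensional ℂ (filtration k S M) := by
  rw [filtration_eq_span hk]
  exact FiniteDimensional.span_of_finite ℂ (Set.finite_range _)

theorem finrank_filtration (hk : 1 ≤ k) (M : ℕ) :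
    Module.finrank ℂ (filtration k S M) = (weightSet k S.natDegree M).card := by
  obtain ⟨b, hb⟩ := exists_basis_monomialXY (S := S) hk
  let φ : weightSet k S.natDegree M → ℕ × Fin k := fun p =>
    (p.1.1, ⟨p.1.2, ((mem_weightSet hk).mp p.2).1⟩)
  have hφ : Function.Injective φ := by
    intro p q h
    simp only [φ, Prod.mk.injEq, Fin.mk.injEq] at h
    exact Subtype.ext (Prod.ext h.1 h.2)
  have hli : LinearIndependent ℂ fun p : weightSet k S.natDegree M => monomialXY k S p := by
    have h := b.linearIndependent.comp φ hφ
    convert! h using 2 with p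
    simp [hb, φ]
  rw [filtration_eq_span hk, finrank_span_eq_card hli, Fintype.card_coe]

/-! ### Riemann's inequality and the conclusion -/

/-- An effective divisor is dominated by the divisor of a regular function that exceeds it in
degree by at most the genus. -/
theorem exists_regular_function (hk : 1 ≤ k) (hS : Squarefree S)
    (hcop : Nat.Coprime S.natDegree k) {g : ℕ}
    (hg : 2 * (g : ℤ) = ((k : ℤ) - 1) * (S.natDegree - 1)) (E : Curve k S →₀ ℕ) :
    ∃ f : CoordinateRing k S, f ≠ 0 ∧ ∃ H : Curve k S →₀ ℕ,
      (∀ z, ord z f = ((E + H) z : ℕ)) ∧ (Finsupp.toMultiset H).card ≤ g := by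
  classical
  have := isDedekindDomain_coordinateRing hk hS hcop
  have hprod := finrank_quotient_prod (K := ℂ) (pointIdeal : Curve k S → _)
    pointIdeal_isMaximal (pointIdeal_ne_bot hk) (fun z a => ⟨_, sub_evalAt_mem z a⟩)
  have hfinF := finiteDimensional_filtration (S := S) hk
  obtain ⟨-, hfin, hcard⟩ := hprod (Finsupp.toMultiset E)
  set n := (Finsupp.toMultiset E).card with hn
  -- `F (n + g)` has dimension at least `n + 1`, one more than the codimension of the ideal of `E`.
  obtain ⟨f, hfJ, hf0, hfM⟩ := exists_ne_zero_mem_filtration (filtration k S) (M := n + g)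
    ((Finsupp.toMultiset E).map pointIdeal).prod (by
      rw [hcard, finrank_filtration hk]
      have := le_two_mul_card_weightSet hk hcop (n + g)
      push_cast at this
      omega)
  choose e he hle using fun z : Curve k S =>
    exists_ord_eq (pointIdeal z) (pointIdeal_ne_bot hk z) hf0
  -- Stated for finite multisets below `e`, since the finiteness of the zero set of `f` is itself
  -- deduced from this bound.
  have hbound : ∀ s : Multiset (Curve k S), (∀ z, s.count z ≤ e z) → s.card ≤ n + g := by
    intro s hs
    rw [← (hprod s).2.2]
    refine (finrank_quotient_le_of_mem_filtration (filtration k S) filtration_mono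
      (exists_mem_filtration hk) hfinF (fun m n a ha b hb => mul_mem_filtration ha hb) g
      (S.natDegree * k) (fun M hM => ?_) hf0 hfM ?_).2
    · rw [finrank_filtration hk]
      have := two_mul_card_weightSet hk hcop hM
      omega
    · exact mem_prod_of_forall_mem_pow_count _ pointIdeal_isMaximal pointIdeal_injective s
        fun z _ => (hle z _).mpr (hs z)
  have hEe : ∀ z, E z ≤ e z := by
    intro z
    rw [← hle, ← Finsupp.count_toMultiset]
    exact mem_pow_count_of_mem_prod _ _ hfJ z
  have hsupp : (Function.support e).Finite := by
    by_contra hinf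
    obtain ⟨T, hT, hTcard⟩ := Set.Infinite.exists_subset_card_eq hinf (n + g + 1)
    have := hbound T.val fun z => by
      by_cases hz : z ∈ T
      · exact (Multiset.nodup_iff_count_le_one.mp T.nodup z).trans
          (Nat.one_le_iff_ne_zero.mpr (hT hz))
      · rw [Multiset.count_eq_zero_of_notMem hz]
        exact Nat.zero_le _
    rw [Finset.card_val, hTcard] at this
    omega
  let G : Curve k S →₀ ℕ := Finsupp.ofSupportFinite e hsupp
  have hEG : E ≤ G := hEe
  refine ⟨f, hf0, G - E, fun z => ?_, ?_⟩
  · rw [add_tsub_cancel_of_le hEG]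
    exact he z
  · have h := hbound (Finsupp.toMultiset G) fun z => by rw [Finsupp.count_toMultiset]; rfl
    rw [← add_tsub_cancel_of_le hEG, map_add, Multiset.card_add] at h
    omega

theorem card_support_le_card_toMultiset {α : Type*} (H : α →₀ ℕ) :
    H.support.card ≤ (Finsupp.toMultiset H).card := by
  rw [Finsupp.card_toMultiset, Finsupp.sum, Finset.card_eq_sum_ones]
  exact Finset.sum_le_sum fun z hz => Nat.one_le_iff_ne_zero.mpr (Finsupp.mem_support_iff.mp hz)

end Superelliptic

end

theorem mainTheorem7 (k : ℕ) (hk : 1 ≤ k) (S : Polynomial ℂ) (hS : Squarefree S)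
    (hcop : Nat.Coprime S.natDegree k)
    (D : Superelliptic.Divisor k S) (hD : ∀ z, 0 ≤ D z) :
    ∃ D' : Superelliptic.Divisor k S, Superelliptic.IsPrincipal D' ∧
      ((D' - D).support.card : ℝ) ≤ ((k : ℝ) - 1) * ((S.natDegree : ℝ) - 1) / 2 := by
  have := Superelliptic.isDomain_coordinateRing hk hS hcop
  obtain ⟨g, hg⟩ := Superelliptic.exists_genus hk hcop
  let E : Superelliptic.Curve k S →₀ ℕ := D.mapRange Int.toNat rfl
  obtain ⟨f, hf0, H, hord, hH⟩ := Superelliptic.exists_regular_function hk hS hcop hg E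
  have hE : ∀ z, (E z : ℤ) = D z := fun z => Int.toNat_of_nonneg (hD z)
  -- The divisor of the regular function `f`, written with denominator `1`; its difference with `D`
  -- is `H`.
  let D' : Superelliptic.Divisor k S := (E + H).mapRange (Nat.cast : ℕ → ℤ) rfl
  refine ⟨D', ⟨algebraMap _ _ f, ?_,
    fun z => ⟨f, 1, one_mem _, by simp, (E + H) z, 0, hord z, ?_, ?_⟩⟩, ?_⟩
  · rwa [Ne, map_eq_zero_iff _ (IsFractionRing.injective _ _)]
  · simp [Superelliptic.ord]
  · simp [D']
  · have hsub : (D' - D).support = H.support := by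
      ext z
      simp [D', ← hE]
    have h1 : (H.support.card : ℝ) ≤ g :=
      Nat.cast_le.mpr ((Superelliptic.card_support_le_card_toMultiset H).trans hH)
    have h2 : 2 * (g : ℝ) = ((k : ℝ) - 1) * ((S.natDegree : ℝ) - 1) := by exact_mod_cast hg
    rw [hsub]
    linarith
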